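/- Let $f\in\,]0,1[$. The infinite group problem (SI) with right-hand side $f$ asks for families $s=(s_r)_{r\in[0,1[}$ of nonnegative integers with finite support such that $\sum_{r} r\,s_r\equiv f \pmod 1$. A function $\pi:[0,1[\,\to\mathbb R$ is valid if $\pi\ge 0$, $\pi(0)=0$ and $\sum_r \pi(r)s_r\ge 1$ for every solution $s$ of (SI). Let $P(\pi)$ be the set of solutions $s$ with $\sum_r\pi(r)s_r=1$. A valid function $\pi$ is a facet if, for every valid function $\pi^*$, $P(\pi)\subseteq P(\pi^*)$ implies $\pi^*=\pi$. A function on $[0,1[$ is called continuous if its $1$-periodic extension to $\mathbb R$ is continuous, and piecewise linear if there are $0=r_0<r_1<\dots<r_k=1$ such that it has the form $a_jr+b_j$ on $[r_{j-1},r_j[$ for $j=1,\dots,k$. Let $0<\alpha<1$ and let $\epsilon_1\ge\epsilon_2\ge\cdots$ be positive real numbers with $\epsilon_1\le 1-\alpha$ and $\sum_{i\ge1}2^{i-1}\epsilon_i<\alpha$. Define $\psi_0(x)=x/\alpha$ for $0\le x\le\alpha$ and $\psi_0(x)=(1-x)/(1-\alpha)$ for $\alpha\le x<1$. For $i\ge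 0$, obtain $\psi_{i+1}$ from $\psi_i$ by replacing, for every maximal interval $[a,b]\subseteq[0,\alpha]$ on which $\psi_i$ has constant positive slope, the segment of the graph over $[a,b]$ by the polygonal line with the successive vertices $$(a,\psi_i(a)),\quad \Bigl(\tfrac{a+b-\epsilon_{i+1}}2,\ \psi_i(\tfrac{a+b}2)+\tfrac{\epsilon_{i+1}}{2(1-\alpha)}\Bigr),\quad \Bigl(\tfrac{a+b+\epsilon_{i+1}}2,\ \psi_i(\tfrac{a+b}2)-\tfrac{\epsilon_{i+1}}{2(1-\alpha)}\Bigr),\quad (b,\psi_i(b)).$$ **Theorem.** The pointwise limit $\psi(x)=\lim_{i\to\infty}\psi_i(x)$ exists for every $x\in[0,1[$, and $\psi$ is a facet of (SI) with $f=\alpha$. Moreover, $\psi$ is continuous and not piecewise linear. Consequently, for every $f\in\,]0,1[$, the Gomory–Johnson facet conjecture is false: not every continuous facet of (SI) is piecewise linear. This remains so when "facet" is understood with only continuous functions admitted as valid functions (for both $\pi$ and $\pi^*$). -/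

import Mathlib

open Set Filter Topology

noncomputable section

namespace InfiniteGroup

/-- The index set `[0,1[`. -/
abbrev UnitIco : Type := Set.Ico (0 : ℝ) 1

/-- `s` is a solution of the infinite group problem with right-hand side `f`: the family `(s_r)` of
nonnegative integers has finite support, and `∑ r s_r = f` modulo `1`. -/
def IsSolution (f : ℝ) (s : UnitIco →₀ ℕ) : Prop :=
  ∃ k : ℤ, (s.sum fun r n => (r : ℝ) * (n : ℝ)) = f + k

/-- The left-hand side `∑ π(r) s_r`. -/
def lhs (π : UnitIco → ℝ) (s : UnitIco →₀ ℕ) : ℝ :=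
  s.sum fun r n => π r * (n : ℝ)

/-- Valid functions. -/
def IsValid (f : ℝ) (π : UnitIco → ℝ) : Prop :=
  (∀ r, 0 ≤ π r) ∧ π ⟨0, by norm_num, by norm_num⟩ = 0 ∧
    ∀ s : UnitIco →₀ ℕ, IsSolution f s → 1 ≤ lhs π s

/-- `P(π)`: the solutions for which the inequality given by `π` is tight. -/
def tightSet (f : ℝ) (π : UnitIco → ℝ) : Set (UnitIco →₀ ℕ) :=
  {s | IsSolution f s ∧ lhs π s = 1}

/-- Facets: valid functions `π` such that `P(π) ⊆ P(π')` forces `π' = π` for every valid `π'`. -/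
def IsFacet (f : ℝ) (π : UnitIco → ℝ) : Prop :=
  IsValid f π ∧ ∀ π' : UnitIco → ℝ, IsValid f π' → tightSet f π ⊆ tightSet f π' → π' = π

/-- The 1-periodic extension to `ℝ` of a function on `[0,1[`. -/
def periodicExt (π : UnitIco → ℝ) (x : ℝ) : ℝ :=
  π ⟨Int.fract x, Int.fract_nonneg x, Int.fract_lt_one x⟩

/-- Continuity of a function on `[0,1[` viewed as a periodic function on `ℝ`. In particular this
gives continuity on `[0,1[`, and moreover the left limit at `1` is the value at `0`. -/
def IsContinuous (π : UnitIco → ℝ) : Prop := Continuous (periodicExt π)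

/-- Facets when only continuous functions are admitted as valid functions. -/
def IsContinuousFacet (f : ℝ) (π : UnitIco → ℝ) : Prop :=
  IsValid f π ∧ IsContinuous π ∧
    ∀ π' : UnitIco → ℝ, IsValid f π' → IsContinuous π' → tightSet f π ⊆ tightSet f π' → π' = π

/-- Piecewise linear: there are `0 = r_0 < r_1 < ⋯ < r_k = 1` such that the function has the form
`a_j x + b_j` on each `[r_{j-1}, r_j[`. -/
def IsPiecewiseLinear (π : UnitIco → ℝ) : Prop :=
  ∃ (k : ℕ) (r : Fin (k + 1) → ℝ) (a b : Fin k → ℝ),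
    StrictMono r ∧ r 0 = 0 ∧ r (Fin.last k) = 1 ∧
      ∀ (j : Fin k) (x : UnitIco), r j.castSucc ≤ (x : ℝ) → (x : ℝ) < r j.succ →
        π x = a j * (x : ℝ) + b j

/-! ### The construction

The functions below are written on all of `ℝ`; only their values on `[0,1[` matter. -/

/-- The triangular function `ψ_0`. -/
def triangle (α x : ℝ) : ℝ := if x ≤ α then x / α else (1 - x) / (1 - α)

/-- `[a,b] ⊆ [0,α]` is a nondegenerate interval where `g` has constant positive slope. -/
def IsPosSlopeInterval (α : ℝ) (g : ℝ → ℝ) (a b : ℝ) : Prop :=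
  0 ≤ a ∧ a < b ∧ b ≤ α ∧ ∃ m : ℝ, 0 < m ∧ ∀ x ∈ Icc a b, g x = g a + m * (x - a)

/-- `[a,b]` is such an interval, maximal with respect to inclusion. -/
def IsMaxPosSlopeInterval (α : ℝ) (g : ℝ → ℝ) (a b : ℝ) : Prop :=
  IsPosSlopeInterval α g a b ∧
    ∀ a' b' : ℝ, IsPosSlopeInterval α g a' b' → Icc a b ⊆ Icc a' b' → a' = a ∧ b' = b

/-- The affine function through `(x₀, y₀)` and `(x₁, y₁)`, evaluated at `x`. -/
def line (x₀ y₀ x₁ y₁ x : ℝ) : ℝ := y₀ + (y₁ - y₀) / (x₁ - x₀) * (x - x₀)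

/-- The three segments (evaluated at `x`) that replace the segment of the graph of `g` over
`[a,b]`, with parameter `e`. -/
def threeSegments (α e : ℝ) (g : ℝ → ℝ) (a b x : ℝ) : ℝ :=
  if x ≤ ((a + b) - e) / 2 then
    line a (g a) (((a + b) - e) / 2) (g ((a + b) / 2) + e / (2 * (1 - α))) x
  else if x ≤ ((a + b) + e) / 2 then
    line (((a + b) - e) / 2) (g ((a + b) / 2) + e / (2 * (1 - α)))
      (((a + b) + e) / 2) (g ((a + b) / 2) - e / (2 * (1 - α))) x
  else
    line (((a + b) + e) / 2) (g ((a + b) / 2) - e / (2 * (1 - α))) b (g b) x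

open Classical in
/-- One step of the construction: over every maximal interval `[a,b] ⊆ [0,α]` where `g` has
constant positive slope, the segment of the graph is replaced by the three segments; elsewhere `g`
is kept. (Two different such intervals meet at most in a common endpoint, and the new function
keeps the value of `g` at endpoints, so the choice made here is immaterial.) -/
def refineStep (α e : ℝ) (g : ℝ → ℝ) (x : ℝ) : ℝ :=
  if h : ∃ p : ℝ × ℝ, IsMaxPosSlopeInterval α g p.1 p.2 ∧ x ∈ Icc p.1 p.2 then
    threeSegments α e g h.choose.1 h.choose.2 x
  else g x

/-- The sequence `ψ_i`. The sequence `ε_1, ε_2, …` is indexed from `0` here: `ε i` is `ε_{i+1}`,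
the parameter of the step from `ψ_i` to `ψ_{i+1}`. -/
def psi (α : ℝ) (ε : ℕ → ℝ) : ℕ → ℝ → ℝ
  | 0 => triangle α
  | i + 1 => refineStep α (ε i) (psi α ε i)

end InfiniteGroup

end

noncomputable section

namespace InfiniteGroup

/-! Up to an affine change, `ψ_n` is a staircase: (1 - α) ψ_n(x) + x extends to a nondecreasing
function `stair` that rises by 1/2^n on each of 2^n equal intervals per period and is constant on
the gaps between them. Refinement cuts a gap of length `ε n` into the middle of each rise. The right
inverse `profile` of the staircase is linear plus accumulated gap lengths, and it is superadditive
because the `ε n` decrease (`exists_superadditive`). Hence the staircases, and their limit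
`stairLim`, are subadditive. With the symmetry x ↦ α - x this gives validity. The bound on the sum
of 2^i ε_i keeps the slopes of the staircases bounded, hence the limit continuous.

For the facet property (`eq_stairLim`), let π' be valid and tight wherever the limit is, and put
q(x) = (1 - α) π'(x) + x. Tightness turns each additivity of the limit staircase into one of q.
These force q to vanish on [-(1 - α), 0], to be equal at the two ends of every flat, and hence to
agree with the limit at all ends of rises. Subadditivity then gives q ≤ `stairLim` everywhere, and
the symmetry turns this into equality.

Flats and rises of the limit accumulate at 0, so no first linear piece can exist. -/

/-- The hypotheses on the parameters of the construction. -/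
structure Admissible (α : ℝ) (ε : ℕ → ℝ) : Prop where
  pos : 0 < α
  lt_one : α < 1
  anti : Antitone ε
  eps_pos : ∀ i, 0 < ε i
  eps_zero_le : ε 0 ≤ 1 - α
  summable : Summable fun i : ℕ => (2 : ℝ) ^ i * ε i
  tsum_lt : ∑' i : ℕ, (2 : ℝ) ^ i * ε i < α

/-- The length of each of the intervals of positive slope of `psi α ε n`. -/
def riseLen (α : ℝ) (ε : ℕ → ℝ) : ℕ → ℝ
  | 0 => α
  | n + 1 => (riseLen α ε n - ε n) / 2

/-- The total length of the gaps between the first `k + 1` intervals of positive slope of the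
periodic extension of `psi α ε n`. -/
def jump (α : ℝ) (ε : ℕ → ℝ) : ℕ → ℤ → ℝ
  | 0, k => (1 - α) * k
  | n + 1, k => jump α ε n (k / 2) + ε n * ((k - k / 2 : ℤ) : ℝ)

/-- The left endpoint of the interval of positive slope with index `k` at stage `n`. -/
def leftEnd (α : ℝ) (ε : ℕ → ℝ) (n : ℕ) (k : ℤ) : ℝ := riseLen α ε n * k + jump α ε n k

/-- The right inverse of the staircase function `level α ε n`. -/
def profile (α : ℝ) (ε : ℕ → ℝ) (n : ℕ) (t : ℝ) : ℝ := riseLen α ε n * t + jump α ε n ⌊t⌋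

/-- The staircase function that increases by one on each interval of positive slope of stage `n`
and is constant on the gaps. -/
def level (α : ℝ) (ε : ℕ → ℝ) (n : ℕ) (x : ℝ) : ℝ := sInf {t | x ≤ profile α ε n t}

variable {α : ℝ} {ε : ℕ → ℝ}

/-! ### Lengths of rises and gaps, and positions of the rises. -/

theorem two_pow_mul_riseLen (n : ℕ) :
    2 ^ n * riseLen α ε n = α - ∑ i ∈ Finset.range n, (2 : ℝ) ^ i * ε i := by
  induction n with
  | zero => simp [riseLen]
  | succ n ih =>
    rw [Finset.sum_range_succ, ← sub_sub, ← ih, riseLen]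
    ring

/-- A positive bound independent of `n`: it yields the common Lipschitz constant of the staircases.
-/
theorem Admissible.le_two_pow_mul_riseLen (h : Admissible α ε) (n : ℕ) :
    α - ∑' i : ℕ, (2 : ℝ) ^ i * ε i ≤ 2 ^ n * riseLen α ε n := by
  rw [two_pow_mul_riseLen]
  have := h.summable.sum_le_tsum (Finset.range n)
    (fun i _ => mul_nonneg (by positivity) (h.eps_pos i).le)
  linarith

theorem Admissible.two_pow_mul_riseLen_le (h : Admissible α ε) (n : ℕ) :
    2 ^ n * riseLen α ε n ≤ α := by
  rw [two_pow_mul_riseLen]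
  have : 0 ≤ ∑ i ∈ Finset.range n, (2 : ℝ) ^ i * ε i :=
    Finset.sum_nonneg fun i _ => mul_nonneg (by positivity) (h.eps_pos i).le
  linarith

theorem Admissible.riseLen_pos (h : Admissible α ε) (n : ℕ) : 0 < riseLen α ε n := by
  have h1 := h.le_two_pow_mul_riseLen n
  have h2 := h.tsum_lt
  have h3 : (0 : ℝ) < 2 ^ n * riseLen α ε n := by linarith
  exact pos_of_mul_pos_right h3 (by positivity)

theorem Admissible.riseLen_le (h : Admissible α ε) (n : ℕ) : riseLen α ε n ≤ (1 / 2) ^ n := by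
  have h1 := h.two_pow_mul_riseLen_le n
  have h2 := h.lt_one
  rw [div_pow, one_pow, le_div_iff₀ (by positivity)]
  linarith

theorem riseLen_eq (n : ℕ) : riseLen α ε n = 2 * riseLen α ε (n + 1) + ε n := by
  rw [riseLen]; ring

theorem Admissible.eps_le (h : Admissible α ε) (n : ℕ) : ε n ≤ 1 - α :=
  (h.anti (Nat.zero_le n)).trans h.eps_zero_le

theorem jump_zero_right (n : ℕ) : jump α ε n 0 = 0 := by
  induction n with
  | zero => simp [jump]
  | succ n ih => simp [jump, ih]

theorem jump_two_mul (n : ℕ) (k : ℤ) : jump α ε (n + 1) (2 * k) = jump α ε n k + ε n * k := by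
  have h1 : 2 * k / 2 = k := by omega
  have h2 : 2 * k - k = k := by omega
  rw [jump, h1, h2]

theorem jump_two_mul_add_one (n : ℕ) (k : ℤ) :
    jump α ε (n + 1) (2 * k + 1) = jump α ε n k + ε n * (k + 1) := by
  have h1 : (2 * k + 1) / 2 = k := by omega
  have h2 : 2 * k + 1 - k = k + 1 := by omega
  rw [jump, h1, h2]
  push_cast
  ring

/-- A gap at stage `n + 1` is either new, of length `ε n`, or inherited from stage `n`. The upper
bound later allows any flat to be crossed by one translation of length at most 1 - α. -/
theorem Admissible.jump_gap (h : Admissible α ε) (n : ℕ) (k : ℤ) :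
    jump α ε n k < jump α ε n (k + 1) ∧ jump α ε n (k + 1) ≤ jump α ε n k + (1 - α) := by
  induction n generalizing k with
  | zero =>
    have := h.lt_one
    simp only [jump]
    push_cast
    constructor <;> linarith
  | succ n ih =>
    rcases Int.even_or_odd' k with ⟨m, rfl | rfl⟩
    · rw [jump_two_mul, jump_two_mul_add_one]
      have := h.eps_pos n
      have := h.eps_le n
      constructor <;> linarith
    · have h2 : 2 * m + 1 + 1 = 2 * (m + 1) := by ring
      rw [h2, jump_two_mul, jump_two_mul_add_one]
      have := ih m
      push_cast
      constructor <;> linarith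

theorem Admissible.jump_mono (h : Admissible α ε) (n : ℕ) : Monotone (jump α ε n) :=
  monotone_int_of_le_succ fun k => (h.jump_gap n k).1.le

/-- `jump` minus its finest linear part is superadditive. -/
theorem Admissible.exists_superadditive (h : Admissible α ε) (n : ℕ) :
    ∃ (K : ℤ → ℝ) (e : ℝ), Monotone K ∧ (∀ k l, K k + K l ≤ K (k + l)) ∧ ε n ≤ e ∧
      ∀ k, jump α ε n k = K k + e * k := by
  induction n with
  | zero =>
    exact ⟨fun _ => 0, 1 - α, monotone_const, by simp, h.eps_zero_le, fun k => by simp [jump]⟩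
  | succ n ih =>
    obtain ⟨K, e, hK, hs, he, hj⟩ := ih
    have hdiv : Monotone fun k : ℤ => k / 2 := fun a b hab => by
      show a / 2 ≤ b / 2
      omega
    -- Of the old slope `e` only `ε n` remains linear in `k`; the excess `e - ε n ≥ 0` multiplies
    -- the superadditive function `k / 2`. Monotonicity of `ε` restores the invariant.
    refine ⟨fun k => K (k / 2) + (e - ε n) * ((k / 2 : ℤ) : ℝ), ε n, ?_, ?_,
      h.anti (Nat.le_succ n), ?_⟩
    · intro a b hab
      have h1 := hK (hdiv hab)
      have h2 : ((a / 2 : ℤ) : ℝ) ≤ ((b / 2 : ℤ) : ℝ) := by exact_mod_cast hdiv hab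
      have h3 := mul_le_mul_of_nonneg_left h2 (sub_nonneg.2 he)
      dsimp only at *
      linarith
    · intro k l
      have h0 : k / 2 + l / 2 ≤ (k + l) / 2 := by omega
      have h1 := (hs (k / 2) (l / 2)).trans (hK h0)
      have h2 : ((k / 2 : ℤ) : ℝ) + ((l / 2 : ℤ) : ℝ) ≤ (((k + l) / 2 : ℤ) : ℝ) := by
        exact_mod_cast h0
      have h3 := mul_le_mul_of_nonneg_left h2 (sub_nonneg.2 he)
      dsimp only at *
      linarith
    · intro k
      rw [jump, hj]
      push_cast
      ring

theorem Admissible.jump_superadditive (h : Admissible α ε) (n : ℕ) (k l : ℤ) :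
    jump α ε n k + jump α ε n l ≤ jump α ε n (k + l) := by
  obtain ⟨K, e, -, hs, -, hj⟩ := h.exists_superadditive n
  have := hs k l
  rw [hj, hj, hj]
  push_cast
  linarith

theorem jump_add_two_pow (n : ℕ) (k : ℤ) :
    jump α ε n (k + 2 ^ n) = jump α ε n k + (1 - 2 ^ n * riseLen α ε n) := by
  induction n generalizing k with
  | zero => simp [jump, riseLen]; ring
  | succ n ih =>
    have h1 : (k + 2 ^ (n + 1)) / 2 = k / 2 + 2 ^ n := by rw [pow_succ]; omega
    rw [jump, h1, ih, jump, riseLen]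
    push_cast
    ring

/-- Each new gap is centred in its rise, so the pattern stays symmetric about α/2. -/
theorem jump_reflect (n : ℕ) (k : ℤ) :
    jump α ε n k + jump α ε n (2 ^ n - 1 - k) = α - 2 ^ n * riseLen α ε n := by
  induction n generalizing k with
  | zero => simp [jump, riseLen]
  | succ n ih =>
    have h1 : (2 ^ (n + 1) - 1 - k) / 2 = 2 ^ n - 1 - k / 2 := by rw [pow_succ]; omega
    have := ih (k / 2)
    rw [jump, jump, h1, riseLen]
    push_cast
    linear_combination this

theorem leftEnd_zero_right (n : ℕ) : leftEnd α ε n 0 = 0 := by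
  simp [leftEnd, jump_zero_right]

theorem leftEnd_two_mul (n : ℕ) (k : ℤ) : leftEnd α ε (n + 1) (2 * k) = leftEnd α ε n k := by
  rw [leftEnd, leftEnd, jump_two_mul, riseLen]
  push_cast
  ring

theorem leftEnd_two_mul_add_one (n : ℕ) (k : ℤ) :
    leftEnd α ε (n + 1) (2 * k + 1) = leftEnd α ε n k + riseLen α ε (n + 1) + ε n := by
  rw [leftEnd, leftEnd, jump_two_mul_add_one, riseLen]
  push_cast
  ring

theorem leftEnd_reflect (n : ℕ) (k : ℤ) :
    leftEnd α ε n (2 ^ n - 1 - k) = α - (leftEnd α ε n k + riseLen α ε n) := by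
  have := jump_reflect (α := α) (ε := ε) n k
  rw [leftEnd, leftEnd]
  push_cast
  linear_combination this

theorem leftEnd_two_pow (n : ℕ) : leftEnd α ε n (2 ^ n) = 1 := by
  have := jump_add_two_pow (α := α) (ε := ε) n 0
  rw [zero_add, jump_zero_right] at this
  rw [leftEnd, this]
  push_cast
  ring

theorem Admissible.leftEnd_gap (h : Admissible α ε) (n : ℕ) (k : ℤ) :
    leftEnd α ε n k + riseLen α ε n < leftEnd α ε n (k + 1) ∧
      leftEnd α ε n (k + 1) ≤ leftEnd α ε n k + riseLen α ε n + (1 - α) := by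
  have := h.jump_gap n k
  rw [leftEnd, leftEnd]
  push_cast
  constructor <;> linarith

theorem Admissible.leftEnd_strictMono (h : Admissible α ε) (n : ℕ) :
    StrictMono (leftEnd α ε n) :=
  strictMono_int_of_lt_succ fun k => by
    have := (h.leftEnd_gap n k).1
    have := h.riseLen_pos n
    linarith

theorem Admissible.exists_leftEnd (h : Admissible α ε) (n : ℕ) (x : ℝ) :
    ∃ k : ℤ, leftEnd α ε n k ≤ x ∧ x < leftEnd α ε n (k + 1) := by
  have hl := h.riseLen_pos n
  have key : ∀ k : ℤ, leftEnd α ε n k ≤ x → k ≤ ⌈|x| / riseLen α ε n⌉ := by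
    intro k hk
    by_contra! hc
    have h1 : |x| / riseLen α ε n < k := (Int.le_ceil _).trans_lt (by exact_mod_cast hc)
    rw [div_lt_iff₀ hl] at h1
    have h2 : 0 ≤ k := by
      have : (0 : ℤ) ≤ ⌈|x| / riseLen α ε n⌉ := Int.ceil_nonneg (by positivity)
      omega
    have h3 := h.jump_mono n h2
    rw [jump_zero_right] at h3
    rw [leftEnd] at hk
    have := le_abs_self x
    linarith
  have ex : ∃ k : ℤ, leftEnd α ε n k ≤ x := by
    refine ⟨-⌈|x| / riseLen α ε n⌉, ?_⟩
    have h0 : (0 : ℤ) ≤ ⌈|x| / riseLen α ε n⌉ := Int.ceil_nonneg (by positivity)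
    have h3 := h.jump_mono n (neg_nonpos.2 h0)
    rw [jump_zero_right] at h3
    have h4 := Int.le_ceil (|x| / riseLen α ε n)
    rw [div_le_iff₀ hl] at h4
    have := neg_abs_le x
    rw [leftEnd]
    push_cast
    linarith
  obtain ⟨k, hk, hmax⟩ := Int.exists_greatest_of_bdd ⟨_, key⟩ ex
  refine ⟨k, hk, ?_⟩
  by_contra! hc
  have := hmax _ hc
  omega

/-! ### The staircase function -/

theorem level_eq_of_forall {n : ℕ} {x t : ℝ} (hx : ∀ s, x ≤ profile α ε n s ↔ t ≤ s) :
    level α ε n x = t := by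
  have : {s | x ≤ profile α ε n s} = Ici t := Set.ext hx
  rw [level, this, csInf_Ici]

theorem Admissible.le_profile_iff_of_mem_rise (h : Admissible α ε) {n : ℕ} {k : ℤ} {x : ℝ}
    (h1 : leftEnd α ε n k ≤ x) (h2 : x ≤ leftEnd α ε n k + riseLen α ε n) (s : ℝ) :
    x ≤ profile α ε n s ↔ k + (x - leftEnd α ε n k) / riseLen α ε n ≤ s := by
  have hl := h.riseLen_pos n
  rw [← le_sub_iff_add_le', div_le_iff₀ hl, profile]
  rw [leftEnd] at *
  rcases lt_trichotomy ⌊s⌋ k with hs | hs | hs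
  · have h3 := h.jump_mono n hs.le
    have h4 : s < k := Int.floor_lt.1 hs
    have h5 := mul_lt_mul_of_pos_left h4 hl
    constructor <;> intro h6 <;> linarith
  · rw [hs]
    constructor <;> intro h6 <;> linarith
  · have h3 := h.jump_mono n hs.le
    have h4 : ((k + 1 : ℤ) : ℝ) ≤ s := Int.le_floor.1 hs
    push_cast at h4
    have h5 := mul_le_mul_of_nonneg_left h4 hl.le
    constructor <;> intro h6 <;> linarith

theorem Admissible.le_profile_iff_of_mem_flat (h : Admissible α ε) {n : ℕ} {k : ℤ} {x : ℝ}
    (h1 : leftEnd α ε n k + riseLen α ε n ≤ x) (h2 : x ≤ leftEnd α ε n (k + 1)) (s : ℝ) :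
    x ≤ profile α ε n s ↔ (k : ℝ) + 1 ≤ s := by
  have hl := h.riseLen_pos n
  rw [profile]
  rw [leftEnd] at *
  push_cast at h2
  constructor
  · intro h3
    by_contra! hc
    have h4 : ⌊s⌋ ≤ k := by
      have : ⌊s⌋ < k + 1 := Int.floor_lt.2 (by exact_mod_cast hc)
      omega
    have h5 := h.jump_mono n h4
    have h6 := mul_lt_mul_of_pos_left hc hl
    linarith
  · intro h3
    have h4 : k + 1 ≤ ⌊s⌋ := Int.le_floor.2 (by exact_mod_cast h3)
    have h5 := h.jump_mono n h4
    have h6 := mul_le_mul_of_nonneg_left h3 hl.le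
    linarith

theorem Admissible.level_of_mem_rise (h : Admissible α ε) {n : ℕ} {k : ℤ} {x : ℝ}
    (h1 : leftEnd α ε n k ≤ x) (h2 : x ≤ leftEnd α ε n k + riseLen α ε n) :
    level α ε n x = k + (x - leftEnd α ε n k) / riseLen α ε n :=
  level_eq_of_forall (h.le_profile_iff_of_mem_rise h1 h2)

theorem Admissible.level_of_mem_flat (h : Admissible α ε) {n : ℕ} {k : ℤ} {x : ℝ}
    (h1 : leftEnd α ε n k + riseLen α ε n ≤ x) (h2 : x ≤ leftEnd α ε n (k + 1)) :
    level α ε n x = k + 1 :=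
  level_eq_of_forall (h.le_profile_iff_of_mem_flat h1 h2)

/-- A Galois connection, through which properties of `level` are read off from `profile`. -/
theorem Admissible.level_le_iff (h : Admissible α ε) {n : ℕ} {x t : ℝ} :
    level α ε n x ≤ t ↔ x ≤ profile α ε n t := by
  obtain ⟨k, h1, h2⟩ := h.exists_leftEnd n x
  rcases le_total x (leftEnd α ε n k + riseLen α ε n) with h3 | h3
  · rw [h.level_of_mem_rise h1 h3, h.le_profile_iff_of_mem_rise h1 h3]
  · rw [h.level_of_mem_flat h3 h2.le, h.le_profile_iff_of_mem_flat h3 h2.le]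

theorem Admissible.level_leftEnd (h : Admissible α ε) (n : ℕ) (k : ℤ) :
    level α ε n (leftEnd α ε n k) = k := by
  have := h.riseLen_pos n
  rw [h.level_of_mem_rise le_rfl (by linarith)]
  simp

theorem Admissible.level_mono (h : Admissible α ε) (n : ℕ) : Monotone (level α ε n) :=
  fun _ _ hxy => h.level_le_iff.2 (hxy.trans (h.level_le_iff.1 le_rfl))

/-- The linear parts cancel; the rest is superadditivity of `jump` and of the floor. -/
theorem Admissible.profile_superadditive (h : Admissible α ε) (n : ℕ) (s t : ℝ) :
    profile α ε n s + profile α ε n t ≤ profile α ε n (s + t) := by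
  have h1 := (h.jump_superadditive n ⌊s⌋ ⌊t⌋).trans (h.jump_mono n (Int.le_floor_add s t))
  simp only [profile]
  linarith

theorem Admissible.level_subadditive (h : Admissible α ε) (n : ℕ) (x y : ℝ) :
    level α ε n (x + y) ≤ level α ε n x + level α ε n y :=
  h.level_le_iff.2 <| (add_le_add (h.level_le_iff.1 le_rfl) (h.level_le_iff.1 le_rfl)).trans
    (h.profile_superadditive n _ _)

/-- `profile` grows at rate at least `riseLen`, so its inverse is Lipschitz. -/
theorem Admissible.level_sub_le (h : Admissible α ε) (n : ℕ) {x y : ℝ} (hxy : x ≤ y) :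
    level α ε n y - level α ε n x ≤ (y - x) / riseLen α ε n := by
  have hl := h.riseLen_pos n
  have hd : 0 ≤ (y - x) / riseLen α ε n := div_nonneg (by linarith) hl.le
  rw [sub_le_iff_le_add', h.level_le_iff]
  have h1 : x ≤ profile α ε n (level α ε n x) := h.level_le_iff.1 le_rfl
  have h2 : ⌊level α ε n x⌋ ≤ ⌊level α ε n x + (y - x) / riseLen α ε n⌋ :=
    Int.floor_mono (by linarith)
  have h3 := h.jump_mono n h2
  have h4 : riseLen α ε n * ((y - x) / riseLen α ε n) = y - x := mul_div_cancel₀ _ hl.ne'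
  rw [profile] at *
  rw [mul_add, h4]
  linarith

theorem Admissible.level_add_one (h : Admissible α ε) (n : ℕ) (x : ℝ) :
    level α ε n (x + 1) = level α ε n x + 2 ^ n := by
  refine eq_of_forall_ge_iff fun t => ?_
  rw [h.level_le_iff, ← le_sub_iff_add_le (b := (2 : ℝ) ^ n), h.level_le_iff]
  have h1 : ⌊t⌋ = ⌊t - 2 ^ n⌋ + 2 ^ n := by
    have := Int.floor_sub_intCast t (2 ^ n)
    push_cast at this
    omega
  rw [profile, profile, h1, jump_add_two_pow]
  constructor <;> intro h2 <;> linarith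

theorem Admissible.level_reflect (h : Admissible α ε) (n : ℕ) (x : ℝ) :
    level α ε n x + level α ε n (α - x) = 2 ^ n := by
  have hl := h.riseLen_pos n
  obtain ⟨k, h1, h2⟩ := h.exists_leftEnd n x
  have hk := leftEnd_reflect (α := α) (ε := ε) n k
  rcases le_total x (leftEnd α ε n k + riseLen α ε n) with h3 | h3
  · rw [h.level_of_mem_rise h1 h3, h.level_of_mem_rise (k := 2 ^ n - 1 - k) (by linarith)
      (by linarith), hk]
    push_cast
    field_simp
    ring
  · have hk' := leftEnd_reflect (α := α) (ε := ε) n (k + 1)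
    have h4 : (2 ^ n - 1 - (k + 1) : ℤ) + 1 = 2 ^ n - 1 - k := by ring
    rw [h.level_of_mem_flat h3 h2.le, h.level_of_mem_flat (k := 2 ^ n - 1 - (k + 1))
      (by linarith) (by rw [h4]; linarith)]
    push_cast
    ring


/-! ### Identification of the construction with the staircases. -/

/-- The staircase function, normalized so that it increases by one over each period. -/
def stair (α : ℝ) (ε : ℕ → ℝ) (n : ℕ) (x : ℝ) : ℝ := level α ε n x / 2 ^ n

/-- The function on `ℝ` whose restriction to `[0,1[` is `psi α ε n`. -/
def psiExt (α : ℝ) (ε : ℕ → ℝ) (n : ℕ) (x : ℝ) : ℝ := (stair α ε n x - x) / (1 - α)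

theorem Admissible.stair_of_mem_rise (h : Admissible α ε) {n : ℕ} {k : ℤ} {x : ℝ}
    (h1 : leftEnd α ε n k ≤ x) (h2 : x ≤ leftEnd α ε n k + riseLen α ε n) :
    stair α ε n x = (k + (x - leftEnd α ε n k) / riseLen α ε n) / 2 ^ n := by
  rw [stair, h.level_of_mem_rise h1 h2]

theorem Admissible.stair_of_mem_flat (h : Admissible α ε) {n : ℕ} {k : ℤ} {x : ℝ}
    (h1 : leftEnd α ε n k + riseLen α ε n ≤ x) (h2 : x ≤ leftEnd α ε n (k + 1)) :
    stair α ε n x = (k + 1) / 2 ^ n := by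
  rw [stair, h.level_of_mem_flat h1 h2]

theorem Admissible.stair_leftEnd (h : Admissible α ε) (n : ℕ) (k : ℤ) :
    stair α ε n (leftEnd α ε n k) = k / 2 ^ n := by
  rw [stair, h.level_leftEnd]

theorem Admissible.psiExt_lt_of_flat (h : Admissible α ε) {n : ℕ} {k : ℤ} {x y : ℝ}
    (h1 : leftEnd α ε n k + riseLen α ε n ≤ x) (hxy : x < y) (h2 : y ≤ leftEnd α ε n (k + 1)) :
    psiExt α ε n y < psiExt α ε n x := by
  have h3 := h.lt_one
  rw [psiExt, psiExt, h.stair_of_mem_flat h1 (hxy.le.trans h2),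
    h.stair_of_mem_flat (h1.trans hxy.le) h2]
  apply div_lt_div_of_pos_right <;> linarith

theorem two_pow_sub_one_leftEnd (n : ℕ) :
    leftEnd α ε n (2 ^ n - 1) + riseLen α ε n = α := by
  have := leftEnd_reflect (α := α) (ε := ε) n 0
  rw [leftEnd_zero_right, sub_zero] at this
  linarith

theorem IsPosSlopeInterval.lt {g : ℝ → ℝ} {a b x y : ℝ} (hg : IsPosSlopeInterval α g a b)
    (hx : a ≤ x) (hxy : x < y) (hy : y ≤ b) : g x < g y := by
  obtain ⟨-, -, -, m, hm, hlin⟩ := hg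
  rw [hlin x ⟨hx, hxy.le.trans hy⟩, hlin y ⟨hx.trans hxy.le, hy⟩]
  have := mul_lt_mul_of_pos_left hxy hm
  linarith

theorem Admissible.isPosSlopeInterval_rise (h : Admissible α ε) {n : ℕ} {g : ℝ → ℝ}
    (hg : ∀ x ∈ Ico (0 : ℝ) 1, g x = psiExt α ε n x) {k : ℤ} (hk0 : 0 ≤ k) (hk : k < 2 ^ n) :
    IsPosSlopeInterval α g (leftEnd α ε n k) (leftEnd α ε n k + riseLen α ε n) := by
  have hl := h.riseLen_pos n
  have hα := h.lt_one
  have h0 : 0 ≤ leftEnd α ε n k := by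
    rw [← leftEnd_zero_right (α := α) (ε := ε) n]
    exact (h.leftEnd_strictMono n).monotone hk0
  have h1 : leftEnd α ε n k + riseLen α ε n ≤ α := by
    have h2 := two_pow_sub_one_leftEnd (α := α) (ε := ε) n
    have : leftEnd α ε n k ≤ leftEnd α ε n (2 ^ n - 1) :=
      (h.leftEnd_strictMono n).monotone (by omega)
    linarith
  refine ⟨h0, by linarith, h1, (1 / (2 ^ n * riseLen α ε n) - 1) / (1 - α), ?_, ?_⟩
  · apply div_pos _ (by linarith)
    rw [sub_pos, lt_div_iff₀ (by positivity)]
    have := h.two_pow_mul_riseLen_le n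
    linarith
  · rintro x ⟨hx1, hx2⟩
    rw [hg x ⟨by linarith, by linarith⟩, hg _ ⟨h0, by linarith⟩, psiExt, psiExt,
      h.stair_of_mem_rise hx1 hx2, h.stair_leftEnd]
    have : 1 - α ≠ 0 := by linarith
    field_simp
    ring

/-- On a flat, `psiExt` strictly decreases, so an interval of positive slope cannot overlap one and
must stay inside a single rise. -/
theorem Admissible.exists_rise_of_isPosSlopeInterval (h : Admissible α ε) {n : ℕ} {g : ℝ → ℝ}
    (hg : ∀ x ∈ Ico (0 : ℝ) 1, g x = psiExt α ε n x) {a b : ℝ}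
    (hab : IsPosSlopeInterval α g a b) :
    ∃ k : ℤ, 0 ≤ k ∧ k < 2 ^ n ∧ leftEnd α ε n k ≤ a ∧ b ≤ leftEnd α ε n k + riseLen α ε n := by
  have hα := h.lt_one
  have hl := h.riseLen_pos n
  obtain ⟨ha0, hlt, hbα, -⟩ := id hab
  obtain ⟨k, h1, h2⟩ := h.exists_leftEnd n a
  have no_flat : ∀ x, a ≤ x → leftEnd α ε n k + riseLen α ε n ≤ x → x < leftEnd α ε n (k + 1) →
      b ≤ x := by
    intro x hx h3 h4
    by_contra! hc
    have h5 : x < min b (leftEnd α ε n (k + 1)) := lt_min hc h4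
    have h6 := min_le_left b (leftEnd α ε n (k + 1))
    have h7 := hab.lt hx h5 h6
    rw [hg _ ⟨by linarith, by linarith⟩, hg _ ⟨by linarith, by linarith⟩] at h7
    exact h7.not_gt (h.psiExt_lt_of_flat h3 h5 (min_le_right _ _))
  refine ⟨k, ?_, ?_, h1, ?_⟩
  · have : leftEnd α ε n 0 < leftEnd α ε n (k + 1) := by
      rw [leftEnd_zero_right]
      linarith
    have := (h.leftEnd_strictMono n).lt_iff_lt.1 this
    omega
  · rw [← (h.leftEnd_strictMono n).lt_iff_lt, leftEnd_two_pow]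
    linarith
  · rcases le_total a (leftEnd α ε n k + riseLen α ε n) with h3 | h3
    · exact no_flat _ h3 le_rfl (h.leftEnd_gap n k).1
    · exact absurd (no_flat a le_rfl h3 h2) (by linarith)

theorem Admissible.isMaxPosSlopeInterval_iff (h : Admissible α ε) {n : ℕ} {g : ℝ → ℝ}
    (hg : ∀ x ∈ Ico (0 : ℝ) 1, g x = psiExt α ε n x) {a b : ℝ} :
    IsMaxPosSlopeInterval α g a b ↔ ∃ k : ℤ, 0 ≤ k ∧ k < 2 ^ n ∧ a = leftEnd α ε n k ∧
      b = leftEnd α ε n k + riseLen α ε n := by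
  have hl := h.riseLen_pos n
  constructor
  · rintro ⟨hab, hmax⟩
    obtain ⟨k, hk0, hk, ha, hb⟩ := h.exists_rise_of_isPosSlopeInterval hg hab
    obtain ⟨h1, h2⟩ := hmax _ _ (h.isPosSlopeInterval_rise hg hk0 hk) (Icc_subset_Icc ha hb)
    exact ⟨k, hk0, hk, h1.symm, h2.symm⟩
  · rintro ⟨k, hk0, hk, rfl, rfl⟩
    refine ⟨h.isPosSlopeInterval_rise hg hk0 hk, fun a' b' hab hsub => ?_⟩
    obtain ⟨j, -, -, ha, hb⟩ := h.exists_rise_of_isPosSlopeInterval hg hab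
    obtain ⟨h1, h2⟩ := (Icc_subset_Icc_iff (by linarith)).1 hsub
    constructor <;> linarith

theorem Admissible.threeSegments_eq (h : Admissible α ε) {n : ℕ} {g : ℝ → ℝ}
    (hg : ∀ x ∈ Ico (0 : ℝ) 1, g x = psiExt α ε n x) {k : ℤ} (hk0 : 0 ≤ k) (hk : k < 2 ^ n)
    {x : ℝ} (hx : x ∈ Icc (leftEnd α ε n k) (leftEnd α ε n k + riseLen α ε n)) :
    threeSegments α (ε n) g (leftEnd α ε n k) (leftEnd α ε n k + riseLen α ε n) x =
      psiExt α ε (n + 1) x := by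
  obtain ⟨hx1, hx2⟩ := hx
  obtain ⟨h0, -, hα', -⟩ := h.isPosSlopeInterval_rise hg hk0 hk
  have hα := h.lt_one
  have hα1 : 1 - α ≠ 0 := by linarith
  have he := h.eps_pos n
  have hl' := h.riseLen_pos (n + 1)
  have hr := riseLen_eq (α := α) (ε := ε) n
  have e0 := leftEnd_two_mul (α := α) (ε := ε) n k
  have e1 := leftEnd_two_mul_add_one (α := α) (ε := ε) n k
  have hl := h.riseLen_pos n
  have ga : g (leftEnd α ε n k) = (k / 2 ^ n - leftEnd α ε n k) / (1 - α) := by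
    rw [hg _ ⟨by linarith, by linarith⟩, psiExt, h.stair_leftEnd]
  have gb : g (leftEnd α ε n k + riseLen α ε n) =
      ((k + 1) / 2 ^ n - (leftEnd α ε n k + riseLen α ε n)) / (1 - α) := by
    rw [hg _ ⟨by linarith, by linarith⟩, psiExt,
      h.stair_of_mem_flat le_rfl (h.leftEnd_gap n k).1.le]
  have gm : g ((leftEnd α ε n k + (leftEnd α ε n k + riseLen α ε n)) / 2) =
      ((k + 1 / 2) / 2 ^ n - (leftEnd α ε n k + riseLen α ε n / 2)) / (1 - α) := by
    rw [hg _ ⟨by linarith, by linarith⟩, psiExt, h.stair_of_mem_rise (k := k) (by linarith)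
      (by linarith)]
    field_simp
    ring
  -- The two inner vertices are the ends of the new gap. The middle segment has slope -1/(1 - α),
  -- exactly the slope of `psiExt` where the staircase is constant.
  have p1 : (leftEnd α ε n k + (leftEnd α ε n k + riseLen α ε n) - ε n) / 2 =
      leftEnd α ε n k + riseLen α ε (n + 1) := by linarith
  have p2 : (leftEnd α ε n k + (leftEnd α ε n k + riseLen α ε n) + ε n) / 2 =
      leftEnd α ε n k + riseLen α ε (n + 1) + ε n := by linarith
  rw [threeSegments, ga, gb, gm, p1, p2, psiExt]
  split_ifs with c1 c2
  · rw [h.stair_of_mem_rise (n := n + 1) (k := 2 * k) (by rw [e0]; exact hx1)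
      (by rw [e0]; exact c1), e0, line, add_sub_cancel_left, hr]
    push_cast
    field_simp
    ring
  · rw [h.stair_of_mem_flat (n := n + 1) (k := 2 * k) (by rw [e0]; linarith)
      (by rw [e1]; exact c2), line, add_sub_cancel_left, hr]
    push_cast
    field_simp
    ring
  · have d1 : leftEnd α ε n k + (2 * riseLen α ε (n + 1) + ε n) -
        (leftEnd α ε n k + riseLen α ε (n + 1) + ε n) = riseLen α ε (n + 1) := by ring
    rw [h.stair_of_mem_rise (n := n + 1) (k := 2 * k + 1) (by rw [e1]; linarith)
      (by rw [e1]; linarith), e1, line, hr, d1]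
    push_cast
    field_simp
    ring

theorem Admissible.stair_succ_of_mem_flat (h : Admissible α ε) {n : ℕ} {k : ℤ} {x : ℝ}
    (h1 : leftEnd α ε n k + riseLen α ε n ≤ x) (h2 : x ≤ leftEnd α ε n (k + 1)) :
    stair α ε (n + 1) x = (k + 1) / 2 ^ n := by
  have e1 := leftEnd_two_mul_add_one (α := α) (ε := ε) n k
  have hr := riseLen_eq (α := α) (ε := ε) n
  have e2 := leftEnd_two_mul (α := α) (ε := ε) n (k + 1)
  have e3 : 2 * k + 1 + 1 = 2 * (k + 1) := by ring
  rw [h.stair_of_mem_flat (k := 2 * k + 1) (by linarith) (by rw [e3, e2]; exact h2)]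
  push_cast
  rw [pow_succ]
  field_simp
  ring

theorem Admissible.psi_eq (h : Admissible α ε) (n : ℕ) :
    ∀ x ∈ Ico (0 : ℝ) 1, psi α ε n x = psiExt α ε n x := by
  have hα := h.lt_one
  have hα0 := h.pos
  have hα1 : 1 - α ≠ 0 := by linarith
  induction n with
  | zero =>
    rintro x ⟨hx0, hx1⟩
    rw [psi, triangle, psiExt]
    have l0 := leftEnd_zero_right (α := α) (ε := ε) 0
    have l1 : leftEnd α ε 0 (0 + 1) = 1 := by simpa using leftEnd_two_pow (α := α) (ε := ε) 0
    have hr : riseLen α ε 0 = α := rfl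
    split_ifs with hx
    · rw [h.stair_of_mem_rise (k := 0) (by rw [l0]; exact hx0) (by rw [l0, hr]; linarith), l0, hr]
      simp
      field_simp
    · rw [h.stair_of_mem_flat (k := 0) (by rw [l0, hr]; linarith) (by rw [l1]; exact hx1.le)]
      simp
  | succ n ih =>
    rintro x ⟨hx0, hx1⟩
    rw [psi, refineStep]
    split_ifs with hex
    -- Whichever interval is chosen, it is a rise containing `x`, and the value does not depend on
    -- which one.
    · obtain ⟨hmax, hmem⟩ := hex.choose_spec
      obtain ⟨k, hk0, hk, ha, hb⟩ := (h.isMaxPosSlopeInterval_iff ih).1 hmax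
      rw [ha, hb] at hmem ⊢
      exact h.threeSegments_eq ih hk0 hk hmem
    -- A point in no rise lies in a flat, where refinement leaves the staircase unchanged.
    · obtain ⟨k, h1, h2⟩ := h.exists_leftEnd n x
      have h3 : leftEnd α ε n k + riseLen α ε n ≤ x := by
        by_contra! hc
        refine hex ⟨(leftEnd α ε n k, leftEnd α ε n k + riseLen α ε n),
          (h.isMaxPosSlopeInterval_iff ih).2 ⟨k, ?_, ?_, rfl, rfl⟩, h1, hc.le⟩
        · have : leftEnd α ε n 0 < leftEnd α ε n (k + 1) := by
            rw [leftEnd_zero_right]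
            linarith
          have := (h.leftEnd_strictMono n).lt_iff_lt.1 this
          omega
        · rw [← (h.leftEnd_strictMono n).lt_iff_lt, leftEnd_two_pow]
          linarith
      rw [ih x ⟨hx0, hx1⟩, psiExt, psiExt, h.stair_of_mem_flat h3 h2.le,
        h.stair_succ_of_mem_flat h3 h2.le]

/-! ### The limit staircase -/

/-- Refinement fixes the values at old left ends, so by monotonicity consecutive stages stay in the
same dyadic interval; this gives geometric convergence. -/
theorem Admissible.stair_mem_Icc (h : Admissible α ε) {n : ℕ} {k : ℤ} {x : ℝ}
    (h1 : leftEnd α ε n k ≤ x) (h2 : x ≤ leftEnd α ε n (k + 1)) :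
    stair α ε n x ∈ Icc (k / 2 ^ n : ℝ) ((k + 1) / 2 ^ n) ∧
      stair α ε (n + 1) x ∈ Icc (k / 2 ^ n : ℝ) ((k + 1) / 2 ^ n) := by
  have a1 := h.level_mono n h1
  have a2 := h.level_mono n h2
  have a3 := h.level_mono (n + 1) h1
  have a4 := h.level_mono (n + 1) h2
  rw [← leftEnd_two_mul] at a3 a4
  rw [h.level_leftEnd] at a1 a2 a3 a4
  push_cast at a1 a2 a3 a4
  simp only [stair, mem_Icc]
  refine ⟨⟨by gcongr, by gcongr⟩, ?_, ?_⟩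
  · rw [pow_succ, div_le_div_iff₀ (by positivity) (by positivity)]
    nlinarith [pow_pos (two_pos (α := ℝ)) n]
  · rw [pow_succ, div_le_div_iff₀ (by positivity) (by positivity)]
    nlinarith [pow_pos (two_pos (α := ℝ)) n]

theorem Admissible.dist_stair_le (h : Admissible α ε) (x : ℝ) (n : ℕ) :
    dist (stair α ε n x) (stair α ε (n + 1) x) ≤ 1 * (1 / 2) ^ n := by
  obtain ⟨k, h1, h2⟩ := h.exists_leftEnd n x
  obtain ⟨a, b⟩ := h.stair_mem_Icc h1 h2.le
  refine (Real.dist_le_of_mem_Icc a b).trans (le_of_eq ?_)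
  rw [div_pow]
  ring

/-- The pointwise limit of the staircase functions. -/
def stairLim (α : ℝ) (ε : ℕ → ℝ) (x : ℝ) : ℝ := limUnder atTop fun n => stair α ε n x

theorem Admissible.tendsto_stair (h : Admissible α ε) (x : ℝ) :
    Tendsto (fun n => stair α ε n x) atTop (𝓝 (stairLim α ε x)) :=
  (cauchySeq_of_le_geometric (1 / 2) 1 (by norm_num) (h.dist_stair_le x)).tendsto_limUnder

theorem Admissible.stairLim_mono (h : Admissible α ε) : Monotone (stairLim α ε) := fun x y hxy =>
  le_of_tendsto_of_tendsto' (h.tendsto_stair x) (h.tendsto_stair y) fun n => by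
    have := h.level_mono n hxy
    rw [stair, stair]
    gcongr

theorem Admissible.stairLim_add_le (h : Admissible α ε) (x y : ℝ) :
    stairLim α ε (x + y) ≤ stairLim α ε x + stairLim α ε y :=
  le_of_tendsto_of_tendsto' (h.tendsto_stair _) ((h.tendsto_stair x).add (h.tendsto_stair y))
    fun n => by
      rw [stair, stair, stair, ← add_div]
      have := h.level_subadditive n x y
      gcongr

theorem Admissible.stairLim_add_one (h : Admissible α ε) (x : ℝ) :
    stairLim α ε (x + 1) = stairLim α ε x + 1 :=
  tendsto_nhds_unique (h.tendsto_stair _) <| ((h.tendsto_stair x).add_const 1).congr fun n => by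
    rw [stair, stair, h.level_add_one, add_div, div_self (by positivity)]

theorem Admissible.stairLim_reflect (h : Admissible α ε) (x : ℝ) :
    stairLim α ε x + stairLim α ε (α - x) = 1 :=
  tendsto_nhds_unique ((h.tendsto_stair x).add (h.tendsto_stair (α - x))) <|
    tendsto_const_nhds.congr fun n => by
      rw [stair, stair, ← add_div, h.level_reflect, div_self (by positivity)]

theorem Admissible.stairLim_of_mem_flat (h : Admissible α ε) {n : ℕ} {k : ℤ} {x : ℝ}
    (h1 : leftEnd α ε n k + riseLen α ε n ≤ x) (h2 : x ≤ leftEnd α ε n (k + 1)) :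
    stairLim α ε x = (k + 1) / 2 ^ n := by
  have key : ∀ m : ℕ, ∃ j : ℤ, leftEnd α ε (n + m) j + riseLen α ε (n + m) ≤ x ∧
      x ≤ leftEnd α ε (n + m) (j + 1) ∧ ((j : ℝ) + 1) / 2 ^ (n + m) = (k + 1) / 2 ^ n := by
    intro m
    induction m with
    | zero => exact ⟨k, h1, h2, rfl⟩
    | succ m ih =>
      obtain ⟨j, a, b, c⟩ := ih
      have e1 := leftEnd_two_mul_add_one (α := α) (ε := ε) (n + m) j
      have e2 := leftEnd_two_mul (α := α) (ε := ε) (n + m) (j + 1)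
      have hr := riseLen_eq (α := α) (ε := ε) (n + m)
      have e3 : 2 * j + 1 + 1 = 2 * (j + 1) := by ring
      -- The flat after rise `j` is the flat after the right half of that rise, which has index `2 *
      -- j + 1`.
      refine ⟨2 * j + 1, ?_, ?_, ?_⟩
      · rw [← add_assoc]
        linarith
      · rw [← add_assoc, e3, e2]
        exact b
      · rw [← c, ← add_assoc, pow_succ]
        push_cast
        field_simp
        ring
  refine tendsto_nhds_unique (h.tendsto_stair x) (tendsto_const_nhds.congr' ?_)
  filter_upwards [eventually_ge_atTop n] with m hm
  obtain ⟨i, rfl⟩ := Nat.exists_eq_add_of_le hm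
  obtain ⟨j, a, b, c⟩ := key i
  rw [h.stair_of_mem_flat a b, c]

theorem Admissible.stairLim_rightEnd (h : Admissible α ε) (n : ℕ) (k : ℤ) :
    stairLim α ε (leftEnd α ε n k + riseLen α ε n) = (k + 1) / 2 ^ n :=
  h.stairLim_of_mem_flat le_rfl (h.leftEnd_gap n k).1.le

theorem Admissible.stairLim_leftEnd (h : Admissible α ε) (n : ℕ) (k : ℤ) :
    stairLim α ε (leftEnd α ε n k) = k / 2 ^ n := by
  have h1 := (h.leftEnd_gap n (k - 1)).1.le
  rw [sub_add_cancel] at h1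
  rw [h.stairLim_of_mem_flat (k := k - 1) h1 (by rw [sub_add_cancel])]
  push_cast
  ring

theorem Admissible.stairLim_zero (h : Admissible α ε) : stairLim α ε 0 = 0 := by
  simpa [leftEnd_zero_right] using h.stairLim_leftEnd 0 0

/-- The flat just left of 0 is the source of the additivity relations that cross flats. -/
theorem Admissible.stairLim_neg (h : Admissible α ε) {t : ℝ} (h0 : 0 ≤ t) (h1 : t ≤ 1 - α) :
    stairLim α ε (-t) = 0 := by
  have e : leftEnd α ε 0 (-1) = -1 := by
    simp only [leftEnd, riseLen, jump]
    push_cast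
    ring
  have e' : leftEnd α ε 0 (-1 + 1) = 0 := by simpa using leftEnd_zero_right (α := α) (ε := ε) 0
  have hr : riseLen α ε 0 = α := rfl
  rw [h.stairLim_of_mem_flat (n := 0) (k := -1) (by linarith) (by linarith)]
  simp

theorem Admissible.stairLim_sub_le (h : Admissible α ε) {x y : ℝ} (hxy : x ≤ y) :
    stairLim α ε y - stairLim α ε x ≤ (y - x) / (α - ∑' i : ℕ, (2 : ℝ) ^ i * ε i) := by
  refine le_of_tendsto' ((h.tendsto_stair y).sub (h.tendsto_stair x)) fun n => ?_
  have h1 := h.level_sub_le n hxy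
  have h2 := h.le_two_pow_mul_riseLen n
  have h3 := h.tsum_lt
  rw [stair, stair, ← sub_div]
  calc (level α ε n y - level α ε n x) / 2 ^ n ≤ (y - x) / riseLen α ε n / 2 ^ n := by gcongr
    _ = (y - x) / (2 ^ n * riseLen α ε n) := by rw [div_div, mul_comm]
    _ ≤ _ := div_le_div_of_nonneg_left (by linarith) (by linarith) h2

theorem Admissible.continuous_stairLim (h : Admissible α ε) : Continuous (stairLim α ε) := by
  have h3 := h.tsum_lt
  refine (LipschitzWith.of_le_add_mul
    (Real.toNNReal (1 / (α - ∑' i : ℕ, (2 : ℝ) ^ i * ε i))) fun x y => ?_).continuous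
  rw [Real.coe_toNNReal _ (by apply div_nonneg <;> linarith), Real.dist_eq]
  rcases le_total x y with hxy | hxy
  · have h1 := h.stairLim_mono hxy
    have h2 : 0 ≤ 1 / (α - ∑' i : ℕ, (2 : ℝ) ^ i * ε i) * |x - y| :=
      mul_nonneg (div_nonneg (by linarith) (by linarith)) (abs_nonneg _)
    linarith
  · have h1 := h.stairLim_sub_le hxy
    rw [abs_of_nonneg (by linarith), one_div_mul_eq_div]
    linarith

/-- The limit fixes integers and is monotone, so its value at n x exceeds n x - 1, while
subadditivity bounds it by n times the value at x. Letting n grow gives the claim. -/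
theorem Admissible.le_stairLim (h : Admissible α ε) (x : ℝ) : x ≤ stairLim α ε x := by
  have hint : ∀ k : ℤ, stairLim α ε k = k := fun k => by
    have := h.stairLim_leftEnd 0 k
    have e : leftEnd α ε 0 k = k := by
      simp only [leftEnd, riseLen, jump]
      ring
    rw [e] at this
    simpa using this
  have hmul : ∀ n : ℕ, stairLim α ε (n * x) ≤ n * stairLim α ε x := by
    intro n
    induction n with
    | zero => simp [h.stairLim_zero]
    | succ n ih =>
      have := h.stairLim_add_le (n * x) x
      push_cast
      rw [add_mul, one_mul]
      linarith
  by_contra! hc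
  obtain ⟨n, hn⟩ := exists_nat_gt (1 / (x - stairLim α ε x))
  rw [div_lt_iff₀ (by linarith)] at hn
  have h1 := h.stairLim_mono (Int.floor_le (n * x))
  rw [hint] at h1
  have h2 := Int.lt_floor_add_one (n * x)
  have h3 := hmul n
  linarith


/-! ### Valid functions and their periodic extensions -/

/-- The class of a real number modulo one. -/
def toUnit (x : ℝ) : UnitIco := ⟨Int.fract x, Int.fract_nonneg x, Int.fract_lt_one x⟩

theorem toUnit_coe (r : UnitIco) : toUnit r = r :=
  Subtype.ext (Int.fract_eq_self.2 ⟨r.2.1, r.2.2⟩)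

theorem periodicExt_coe (π : UnitIco → ℝ) (r : UnitIco) : periodicExt π r = π r :=
  congrArg π (toUnit_coe r)

theorem periodicExt_add_int (π : UnitIco → ℝ) (x : ℝ) (k : ℤ) :
    periodicExt π (x + k) = periodicExt π x := by
  simp only [periodicExt, Int.fract_add_intCast]

theorem lhs_add (π : UnitIco → ℝ) (s s' : UnitIco →₀ ℕ) :
    lhs π (s + s') = lhs π s + lhs π s' :=
  Finsupp.sum_add_index' (by simp) fun r m n => by push_cast; ring

theorem lhs_single_toUnit (π : UnitIco → ℝ) (x : ℝ) :
    lhs π (Finsupp.single (toUnit x) 1) = periodicExt π x := by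
  rw [lhs, Finsupp.sum_single_index (by simp), Nat.cast_one, mul_one, periodicExt, toUnit]

theorem isSolution_iff (f : ℝ) (s : UnitIco →₀ ℕ) :
    IsSolution f s ↔ ∃ k : ℤ, lhs (fun r => (r : ℝ)) s = f + k := Iff.rfl

theorem lhs_coe_single_toUnit (x : ℝ) :
    lhs (fun r => (r : ℝ)) (Finsupp.single (toUnit x) 1) = x - ⌊x⌋ := by
  rw [lhs, Finsupp.sum_single_index (by simp), Nat.cast_one, mul_one]
  rfl

theorem isSolution_pair (x f : ℝ) :
    IsSolution f (Finsupp.single (toUnit x) 1 + Finsupp.single (toUnit (f - x)) 1) := by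
  rw [isSolution_iff, lhs_add, lhs_coe_single_toUnit, lhs_coe_single_toUnit]
  refine ⟨-⌊x⌋ - ⌊f - x⌋, ?_⟩
  push_cast
  ring

theorem isSolution_triple (x y f : ℝ) :
    IsSolution f (Finsupp.single (toUnit x) 1 + Finsupp.single (toUnit y) 1 +
      Finsupp.single (toUnit (f - (x + y))) 1) := by
  rw [isSolution_iff, lhs_add, lhs_add, lhs_coe_single_toUnit, lhs_coe_single_toUnit,
    lhs_coe_single_toUnit]
  refine ⟨-⌊x⌋ - ⌊y⌋ - ⌊f - (x + y)⌋, ?_⟩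
  push_cast
  ring

/-- A nonnegative function whose periodic extension is subadditive is valid when it vanishes at `0`
and has value `1` at `f`. -/
theorem isValid_of_subadditive {f : ℝ} {π : UnitIco → ℝ} (hnn : ∀ r, 0 ≤ π r)
    (h0 : periodicExt π 0 = 0) (hf : periodicExt π f = 1)
    (hsub : ∀ x y, periodicExt π (x + y) ≤ periodicExt π x + periodicExt π y) :
    IsValid f π := by
  refine ⟨hnn, ?_, fun s hs => ?_⟩
  · exact (periodicExt_coe π ⟨0, by norm_num, by norm_num⟩).symm.trans h0
  · obtain ⟨k, hk⟩ := hs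
    have hmul : ∀ (x : ℝ) (n : ℕ), periodicExt π (x * n) ≤ periodicExt π x * n := by
      intro x n
      induction n with
      | zero => simp [h0]
      | succ n ih =>
        have := hsub (x * n) x
        push_cast
        rw [mul_add_one, mul_add_one]
        linarith
    have h1 : periodicExt π (s.sum fun r n => (r : ℝ) * (n : ℝ)) ≤
        s.sum fun r n => periodicExt π ((r : ℝ) * (n : ℝ)) :=
      Finset.le_sum_of_subadditive _ h0.le hsub _ _
    rw [hk, periodicExt_add_int, hf] at h1
    refine h1.trans (Finset.sum_le_sum fun r _ => ?_)
    simpa only [periodicExt_coe] using hmul r (s r)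

section Tight

variable {f : ℝ} {π π' : UnitIco → ℝ}

theorem periodicExt_reflect_of_tightSet_subset
    (hsym : ∀ x, periodicExt π x + periodicExt π (f - x) = 1)
    (hsub : tightSet f π ⊆ tightSet f π') (x : ℝ) :
    periodicExt π' x + periodicExt π' (f - x) = 1 := by
  have := (hsub ⟨isSolution_pair x f, by
    rw [lhs_add, lhs_single_toUnit, lhs_single_toUnit, hsym]⟩).2
  rwa [lhs_add, lhs_single_toUnit, lhs_single_toUnit] at this

/-- Given the symmetry, the solution consisting of x, y and f - (x + y) is tight for a function
exactly when that function is additive at (x, y). -/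
theorem periodicExt_add_of_tightSet_subset
    (hsym : ∀ x, periodicExt π x + periodicExt π (f - x) = 1)
    (hsub : tightSet f π ⊆ tightSet f π') {x y : ℝ}
    (hxy : periodicExt π (x + y) = periodicExt π x + periodicExt π y) :
    periodicExt π' (x + y) = periodicExt π' x + periodicExt π' y := by
  have h1 := (hsub ⟨isSolution_triple x y f, by
    rw [lhs_add, lhs_add, lhs_single_toUnit, lhs_single_toUnit, lhs_single_toUnit, ← hxy,
      hsym]⟩).2
  rw [lhs_add, lhs_add, lhs_single_toUnit, lhs_single_toUnit, lhs_single_toUnit] at h1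
  have h2 := periodicExt_reflect_of_tightSet_subset hsym hsub (x + y)
  linarith

theorem periodicExt_add_le_of_reflect (hv : IsValid f π)
    (hsym : ∀ x, periodicExt π x + periodicExt π (f - x) = 1) (x y : ℝ) :
    periodicExt π (x + y) ≤ periodicExt π x + periodicExt π y := by
  have h1 := hv.2.2 _ (isSolution_triple x y f)
  rw [lhs_add, lhs_add, lhs_single_toUnit, lhs_single_toUnit, lhs_single_toUnit] at h1
  have h2 := hsym (x + y)
  linarith

end Tight

/-- A bounded function that is additive on `[0,c]` and vanishes at `c` is zero on `[0,c]`. -/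
theorem eq_zero_of_additive_of_bounded {c M : ℝ} {g : ℝ → ℝ}
    (hadd : ∀ s t, 0 ≤ s → 0 ≤ t → s + t ≤ c → g (s + t) = g s + g t) (hc : g c = 0)
    (hM : ∀ t, |g t| ≤ M) {t : ℝ} (h0 : 0 ≤ t) (h1 : t ≤ c) : g t = 0 := by
  have key : ∀ n : ℕ, ∀ t, 0 ≤ t → t ≤ c → |g t| ≤ M * (1 / 2) ^ n := by
    intro n
    induction n with
    | zero => intro t _ _; simpa using hM t
    | succ n ih =>
      -- Doubling halves the bound on the lower half of [0,c]; the relation g(c - t) = -g(t) carries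
      -- it to the upper half.
      have half : ∀ t, 0 ≤ t → t + t ≤ c → |g t| ≤ M * (1 / 2) ^ (n + 1) := by
        intro t h0 h1
        have h2 := ih (t + t) (by linarith) h1
        rw [hadd t t h0 h0 h1, ← two_mul, abs_mul, abs_two] at h2
        rw [pow_succ]
        linarith
      intro t h0 h1
      rcases le_total (t + t) c with h2 | h2
      · exact half t h0 h2
      · have h3 := half (c - t) (by linarith) (by linarith)
        have h4 := hadd t (c - t) h0 (by linarith) (by linarith)
        rw [add_sub_cancel, hc] at h4
        rwa [show g (c - t) = -g t by linarith, abs_neg] at h3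
  have hlim : Tendsto (fun n : ℕ => M * (1 / 2 : ℝ) ^ n) atTop (𝓝 (M * 0)) :=
    (tendsto_pow_atTop_nhds_zero_of_lt_one (by norm_num) (by norm_num)).const_mul M
  rw [mul_zero] at hlim
  have := ge_of_tendsto' hlim fun n => key n t h0 h1
  exact abs_eq_zero.1 (le_antisymm this (abs_nonneg _))

/-! ### The limit function -/

/-- The pointwise limit of `psi α ε n`. -/
def psiLim (α : ℝ) (ε : ℕ → ℝ) (r : UnitIco) : ℝ := (stairLim α ε r - r) / (1 - α)

theorem Admissible.tendsto_psi (h : Admissible α ε) (r : UnitIco) :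
    Tendsto (fun n => psi α ε n r) atTop (𝓝 (psiLim α ε r)) :=
  (((h.tendsto_stair r).sub_const _).div_const _).congr fun n => (h.psi_eq n r r.2).symm

theorem Admissible.stairLim_add_int (h : Admissible α ε) (x : ℝ) (k : ℤ) :
    stairLim α ε (x + k) = stairLim α ε x + k := by
  have hp : Function.Periodic (fun x => stairLim α ε x - x) 1 := fun x => by
    simp only [h.stairLim_add_one]
    ring
  have := hp.int_mul k x
  simp only [mul_one] at this
  linarith

theorem Admissible.periodicExt_psiLim (h : Admissible α ε) (x : ℝ) :
    periodicExt (psiLim α ε) x = (stairLim α ε x - x) / (1 - α) := by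
  have := h.stairLim_add_int (Int.fract x) ⌊x⌋
  have hx := Int.fract_add_floor x
  rw [hx] at this
  rw [periodicExt, psiLim]
  congr 1
  dsimp only
  linarith

theorem Admissible.isContinuous_psiLim (h : Admissible α ε) : IsContinuous (psiLim α ε) := by
  rw [IsContinuous, funext h.periodicExt_psiLim]
  exact (h.continuous_stairLim.sub continuous_id).div_const _

theorem Admissible.periodicExt_psiLim_reflect (h : Admissible α ε) (x : ℝ) :
    periodicExt (psiLim α ε) x + periodicExt (psiLim α ε) (α - x) = 1 := by
  have h1 := h.stairLim_reflect x
  have h2 : 1 - α ≠ 0 := by linarith [h.lt_one]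
  rw [h.periodicExt_psiLim, h.periodicExt_psiLim, ← add_div, div_eq_one_iff_eq h2]
  linarith

theorem Admissible.isValid_psiLim (h : Admissible α ε) : IsValid α (psiLim α ε) := by
  have hα : 0 < 1 - α := by linarith [h.lt_one]
  have h0 : periodicExt (psiLim α ε) 0 = 0 := by simp [h.periodicExt_psiLim, h.stairLim_zero]
  refine isValid_of_subadditive (fun r => ?_) h0 ?_ fun x y => ?_
  · exact div_nonneg (sub_nonneg.2 (h.le_stairLim r)) hα.le
  · have := h.periodicExt_psiLim_reflect 0
    rwa [h0, zero_add, sub_zero] at this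
  · simp only [h.periodicExt_psiLim]
    rw [← add_div]
    have := h.stairLim_add_le x y
    gcongr
    linarith

/-! ### Uniqueness and the facet property. -/

/-- If `q` is additive wherever the limit staircase is, and `q` is subadditive up to the obvious
normalization, then `q` is the limit staircase. -/
theorem Admissible.eq_stairLim (h : Admissible α ε) {q : ℝ → ℝ} {M : ℝ}
    (hM : ∀ x, |q x - stairLim α ε x| ≤ M)
    (hadd : ∀ x y, stairLim α ε (x + y) = stairLim α ε x + stairLim α ε y →
      q (x + y) = q x + q y)
    (hsub : ∀ x y, q (x + y) ≤ q x + q y)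
    (hper : ∀ x, q (x + 1) = q x + 1)
    (hrefl : ∀ x, q x + q (α - x) = 1) (x : ℝ) : q x = stairLim α ε x := by
  have hα : 0 < 1 - α := by linarith [h.lt_one]
  have q0 : q 0 = 0 := by
    have := hadd 0 0 (by simp [h.stairLim_zero])
    rw [add_zero] at this
    linarith
  have qneg : ∀ t, 0 ≤ t → t ≤ 1 - α → q (-t) = 0 := by
    intro t h0 h1
    have := eq_zero_of_additive_of_bounded (c := 1 - α) (M := M)
      (g := fun t => q (-t) - stairLim α ε (-t)) ?_ ?_ (fun t => hM (-t)) h0 h1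
    · simpa [h.stairLim_neg h0 h1] using this
    · intro s t hs ht hst
      have e := h.stairLim_neg (add_nonneg hs ht) hst
      have e1 := h.stairLim_neg hs (by linarith)
      have e2 := h.stairLim_neg ht (by linarith)
      simp only [e, e1, e2]
      rw [neg_add] at *
      rw [hadd _ _ (by rw [e, e1, e2, add_zero])]
      ring
    -- Vanishing at the end 1 - α: q(α) = 1 by reflection, and α - 1 is one period to the left.
    · have h1 := hrefl 0
      have h2 := hper (-(1 - α))
      rw [q0, sub_zero] at h1
      rw [show -(1 - α) + 1 = α by ring] at h2
      simp only [h.stairLim_neg hα.le le_rfl]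
      linarith
  -- moving left by at most `1 - α` inside a flat piece
  have hflat : ∀ x t, 0 ≤ t → t ≤ 1 - α → stairLim α ε (x - t) = stairLim α ε x →
      q (x - t) = q x := by
    intro x t h0 h1 h2
    have := hadd x (-t) (by rw [h.stairLim_neg h0 h1, add_zero, ← h2, sub_eq_add_neg])
    rwa [qneg t h0 h1, add_zero, ← sub_eq_add_neg] at this
  have Glen : ∀ n, stairLim α ε (riseLen α ε n) = 1 / 2 ^ n := fun n => by
    simpa [leftEnd_zero_right] using h.stairLim_rightEnd n 0
  have qlen : ∀ n, q (riseLen α ε n) = 1 / 2 ^ n := by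
    intro n
    induction n with
    | zero =>
      have := hrefl 0
      rw [q0, sub_zero] at this
      rw [riseLen, pow_zero]
      linarith
    | succ n ih =>
      have e : stairLim α ε (riseLen α ε (n + 1) + ε n) = 1 / 2 ^ (n + 1) := by
        have := h.stairLim_leftEnd (n + 1) (2 * 0 + 1)
        rw [leftEnd_two_mul_add_one, leftEnd_zero_right] at this
        simpa using this
      have h1 := hflat (riseLen α ε (n + 1) + ε n) (ε n) (h.eps_pos n).le (h.eps_le n)
        (by rw [add_sub_cancel_right, Glen, e])
      rw [add_sub_cancel_right] at h1
      -- A rise of stage `n` is the sum of the two ends of its first new gap, at which `q` takes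
      -- equal values; so `q` halves.
      have e2 : riseLen α ε (n + 1) + (riseLen α ε (n + 1) + ε n) = riseLen α ε n := by
        rw [riseLen_eq n]
        ring
      have h2 := hadd (riseLen α ε (n + 1)) (riseLen α ε (n + 1) + ε n)
        (by rw [e2, Glen, Glen, e, pow_succ]; field_simp; ring)
      rw [e2, ih, ← h1] at h2
      rw [pow_succ, ← div_div]
      linarith
  have qright : ∀ (n : ℕ) (k : ℕ), q (leftEnd α ε n k) = k / 2 ^ n ∧
      q (leftEnd α ε n k + riseLen α ε n) = (k + 1) / 2 ^ n := by
    intro n k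
    have step : ∀ k : ℕ, q (leftEnd α ε n k) = k / 2 ^ n →
        q (leftEnd α ε n k + riseLen α ε n) = (k + 1) / 2 ^ n := by
      intro k hk
      rw [hadd, hk, qlen, ← add_div]
      have := h.stairLim_rightEnd n k
      rw [this, h.stairLim_leftEnd, Glen]
      ring
    suffices q (leftEnd α ε n k) = k / 2 ^ n from ⟨this, step k this⟩
    induction k with
    | zero => simp [leftEnd_zero_right, q0]
    | succ k ih =>
      have h1 := h.leftEnd_gap n k
      have h2 := step k ih
      have h3 := hflat (leftEnd α ε n ((k : ℤ) + 1))
        (leftEnd α ε n ((k : ℤ) + 1) - (leftEnd α ε n k + riseLen α ε n))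
        (by linarith) (by linarith) (by
          rw [sub_sub_cancel, h.stairLim_rightEnd, h.stairLim_leftEnd]
          push_cast
          ring)
      rw [sub_sub_cancel, h2] at h3
      push_cast
      exact h3.symm
  have hle0 : ∀ x, 0 ≤ x → q x ≤ stairLim α ε x := by
    intro x hx
    have bound : ∀ n, riseLen α ε n ≤ 1 - α → q x ≤ stairLim α ε x + (1 / 2) ^ n := by
      intro n hn
      obtain ⟨j, h1, h2⟩ := h.exists_leftEnd n x
      have hj : 0 ≤ j := by
        have : leftEnd α ε n 0 < leftEnd α ε n (j + 1) := by
          rw [leftEnd_zero_right]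
          linarith
        have := (h.leftEnd_strictMono n).lt_iff_lt.1 this
        omega
      lift j to ℕ using hj
      -- No monotonicity of `q` is available; moving right by at most 1 - α is a substitute, since
      -- `q` vanishes on the flat left of 0. It compares `x` with the right end of its rise or flat.
      have key : ∀ d, 0 ≤ d - x → d - x ≤ 1 - α → q x ≤ q d := by
        intro d h3 h4
        have := hsub d (-(d - x))
        rwa [qneg _ h3 h4, add_zero, neg_sub, add_sub_cancel] at this
      have h5 := h.stairLim_mono h1
      rw [h.stairLim_leftEnd] at h5
      have h6 : q x ≤ (j + 1) / 2 ^ n := by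
        rcases le_total x (leftEnd α ε n j + riseLen α ε n) with h3 | h3
        · rw [← (qright n j).2]
          exact key _ (by linarith) (by linarith)
        · have h4 := (qright n (j + 1)).1
          push_cast at h4
          rw [← h4]
          have := (h.leftEnd_gap n j).2
          exact key _ (by linarith) (by linarith)
      rw [div_pow, one_pow]
      rw [add_div] at h6
      push_cast at h5
      linarith
    have hlim : Tendsto (fun n : ℕ => stairLim α ε x + (1 / 2 : ℝ) ^ n) atTop
        (𝓝 (stairLim α ε x + 0)) :=
      (tendsto_pow_atTop_nhds_zero_of_lt_one (by norm_num) (by norm_num)).const_add _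
    rw [add_zero] at hlim
    refine ge_of_tendsto hlim ?_
    filter_upwards [(tendsto_pow_atTop_nhds_zero_of_lt_one (r := (1 / 2 : ℝ)) (by norm_num)
      (by norm_num)).eventually (ge_mem_nhds hα)] with n hn
    exact bound n ((h.riseLen_le n).trans hn)
  have hle : ∀ x, q x ≤ stairLim α ε x := by
    intro x
    have hp : Function.Periodic (fun x => q x - stairLim α ε x) 1 := fun x => by
      simp only [h.stairLim_add_one, hper]
      ring
    have h1 := hp.sub_int_mul_eq (x := x) ⌊x⌋
    have h2 := hle0 (Int.fract x) (Int.fract_nonneg x)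
    rw [← Int.self_sub_floor] at h2
    simp only [mul_one] at h1
    linarith
  -- The inequalities at x and α - x add up to 1 ≤ 1, so both are equalities.
  have h1 := hle x
  have h2 := hle (α - x)
  have h3 := hrefl x
  have h4 := h.stairLim_reflect x
  linarith

theorem Admissible.isFacet_psiLim (h : Admissible α ε) : IsFacet α (psiLim α ε) := by
  refine ⟨h.isValid_psiLim, fun π hv hsub => ?_⟩
  have hα : 0 < 1 - α := by linarith [h.lt_one]
  have hrefl := periodicExt_reflect_of_tightSet_subset h.periodicExt_psiLim_reflect hsub
  have hnn : ∀ x, 0 ≤ periodicExt π x := fun x => hv.1 _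
  have hnn' : ∀ x, 0 ≤ periodicExt (psiLim α ε) x := fun x => h.isValid_psiLim.1 _
  have hst : ∀ x, stairLim α ε x = (1 - α) * periodicExt (psiLim α ε) x + x := fun x => by
    rw [h.periodicExt_psiLim]
    field_simp
    ring
  have key : ∀ x, (1 - α) * periodicExt π x + x = stairLim α ε x := by
    refine h.eq_stairLim (M := 1 - α) (fun x => ?_) (fun x y hxy => ?_) (fun x y => ?_)
      (fun x => ?_) fun x => ?_
    -- Nonnegativity and reflection confine both periodic extensions to [0,1], hence the constant 1
    -- - α.
    · rw [hst, add_sub_add_right_eq_sub, ← mul_sub, abs_mul, abs_of_pos hα]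
      apply mul_le_of_le_one_right hα.le
      rw [abs_le]
      have := hrefl x
      have := h.periodicExt_psiLim_reflect x
      have := hnn x
      have := hnn' x
      have := hnn (α - x)
      have := hnn' (α - x)
      constructor <;> linarith
    · rw [hst, hst, hst] at hxy
      have h1 : periodicExt (psiLim α ε) (x + y) =
          periodicExt (psiLim α ε) x + periodicExt (psiLim α ε) y :=
        mul_left_cancel₀ hα.ne' (by linarith)
      rw [periodicExt_add_of_tightSet_subset h.periodicExt_psiLim_reflect hsub h1]
      ring
    · have := mul_le_mul_of_nonneg_left (periodicExt_add_le_of_reflect hv hrefl x y) hα.le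
      linarith
    · have := periodicExt_add_int π x 1
      rw [Int.cast_one] at this
      rw [this]
      ring
    · linear_combination (1 - α) * hrefl x
  funext r
  have h1 := key r
  rw [hst, periodicExt_coe, periodicExt_coe] at h1
  exact mul_left_cancel₀ hα.ne' (by linarith)

/-! ### Failure of piecewise linearity, and existence of parameters. -/

theorem Admissible.not_isPiecewiseLinear_psiLim (h : Admissible α ε) :
    ¬ IsPiecewiseLinear (psiLim α ε) := by
  rintro ⟨k, r, a, b, hr, hr0, hr1, hlin⟩
  have hα : 0 < 1 - α := by linarith [h.lt_one]
  rcases k with _ | k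
  · have : Fin.last 0 = 0 := rfl
    rw [this, hr0] at hr1
    exact zero_ne_one hr1
  have hpos : 0 < r (Fin.succ 0) := by
    rw [← hr0]
    exact hr (Fin.succ_pos 0)
  have hle : r (Fin.succ 0) ≤ 1 := by
    rw [← hr1]
    exact hr.monotone (Fin.le_last _)
  have hG : ∀ x, 0 ≤ x → x < r (Fin.succ 0) →
      stairLim α ε x = (1 - α) * (a 0 * x + b 0) + x := by
    intro x h0 h1
    have := hlin 0 ⟨x, h0, by linarith⟩ (by simpa [hr0] using h0) h1
    rw [psiLim] at this
    rw [← this]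
    field_simp
    ring
  -- For `n` large the first linear piece contains the first rise and first gap of stage `n + 1`:
  -- the gap forces slope zero of the staircase, the rise a positive increase.
  obtain ⟨n, hn⟩ := exists_pow_lt_of_lt_one hpos (by norm_num : (1 / 2 : ℝ) < 1)
  have hl := h.riseLen_pos (n + 1)
  have he := h.eps_pos n
  have hlt := (h.riseLen_le n).trans_lt hn
  have hr' := riseLen_eq (α := α) (ε := ε) n
  have g0 := hG 0 le_rfl hpos
  have g1 := hG (riseLen α ε (n + 1)) hl.le (by linarith)
  have g2 := hG (riseLen α ε (n + 1) + ε n) (by linarith) (by linarith)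
  rw [h.stairLim_zero] at g0
  have e1 : stairLim α ε (riseLen α ε (n + 1)) = 1 / 2 ^ (n + 1) := by
    simpa [leftEnd_zero_right] using h.stairLim_rightEnd (n + 1) 0
  have e2 : stairLim α ε (riseLen α ε (n + 1) + ε n) = 1 / 2 ^ (n + 1) := by
    have := h.stairLim_leftEnd (n + 1) (2 * 0 + 1)
    rw [leftEnd_two_mul_add_one, leftEnd_zero_right] at this
    simpa using this
  rw [e1] at g1
  rw [e2] at g2
  have h1 : ((1 - α) * a 0 + 1) * ε n = 0 := by linarith
  have h2 : (1 - α) * a 0 + 1 = 0 := (mul_eq_zero.1 h1).resolve_right he.ne'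
  have h3 : (1 : ℝ) / 2 ^ (n + 1) = ((1 - α) * a 0 + 1) * riseLen α ε (n + 1) := by linarith
  rw [h2, zero_mul] at h3
  exact absurd h3 (by positivity)

theorem exists_admissible {f : ℝ} (h0 : 0 < f) (h1 : f < 1) : ∃ ε : ℕ → ℝ, Admissible f ε := by
  -- With ratio 1/4 the weighted sum is 2δ, so δ must satisfy both 2δ < f and δ ≤ 1 - f.
  set δ := f * (1 - f) / 3 with hδ
  have hδ0 : 0 < δ := div_pos (mul_pos h0 (by linarith)) (by norm_num)
  have hs : HasSum (fun i : ℕ => (2 : ℝ) ^ i * (δ * (1 / 4) ^ i)) (δ * 2) := by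
    have := (hasSum_geometric_two).mul_left δ
    refine this.congr_fun fun i => ?_
    rw [mul_left_comm, ← mul_pow]
    norm_num
  refine ⟨fun i => δ * (1 / 4) ^ i, h0, h1, fun i j hij => ?_, fun i => by positivity, ?_,
    hs.summable, ?_⟩
  · exact mul_le_mul_of_nonneg_left
      (pow_le_pow_of_le_one (by norm_num) (by norm_num) hij) hδ0.le
  · simp only [pow_zero, mul_one]
    nlinarith
  · rw [hs.tsum_eq]
    nlinarith

theorem IsFacet.isContinuousFacet {f : ℝ} {π : UnitIco → ℝ} (h : IsFacet f π)
    (hc : IsContinuous π) : IsContinuousFacet f π :=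
  ⟨h.1, hc, fun π' hv _ hsub => h.2 π' hv hsub⟩

end InfiniteGroup

end

theorem mainTheorem1 :
    (∀ (α : ℝ) (ε : ℕ → ℝ), 0 < α → α < 1 →
      Antitone ε → (∀ i, 0 < ε i) → ε 0 ≤ 1 - α →
      Summable (fun i : ℕ => (2 : ℝ) ^ i * ε i) → (∑' i : ℕ, (2 : ℝ) ^ i * ε i) < α →
      ∃ ψ : InfiniteGroup.UnitIco → ℝ,
        (∀ x : InfiniteGroup.UnitIco,
          Tendsto (fun i : ℕ => InfiniteGroup.psi α ε i (x : ℝ)) atTop (𝓝 (ψ x))) ∧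
        InfiniteGroup.IsFacet α ψ ∧
        InfiniteGroup.IsContinuous ψ ∧
        ¬ InfiniteGroup.IsPiecewiseLinear ψ) ∧
    (∀ f : ℝ, 0 < f → f < 1 →
      (¬ ∀ π : InfiniteGroup.UnitIco → ℝ, InfiniteGroup.IsFacet f π →
          InfiniteGroup.IsContinuous π → InfiniteGroup.IsPiecewiseLinear π) ∧
      (¬ ∀ π : InfiniteGroup.UnitIco → ℝ, InfiniteGroup.IsContinuousFacet f π →
          InfiniteGroup.IsPiecewiseLinear π)) := by
  refine ⟨fun α ε h0 h1 hanti hpos hle hsum hlt => ?_, fun f h0 h1 => ?_⟩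
  · have h : InfiniteGroup.Admissible α ε := ⟨h0, h1, hanti, hpos, hle, hsum, hlt⟩
    exact ⟨InfiniteGroup.psiLim α ε, h.tendsto_psi, h.isFacet_psiLim, h.isContinuous_psiLim,
      h.not_isPiecewiseLinear_psiLim⟩
  · obtain ⟨ε, h⟩ := InfiniteGroup.exists_admissible h0 h1
    exact ⟨fun H => h.not_isPiecewiseLinear_psiLim
        (H _ h.isFacet_psiLim h.isContinuous_psiLim),
      fun H => h.not_isPiecewiseLinear_psiLim
        (H _ (h.isFacet_psiLim.isContinuousFacet h.isContinuous_psiLim))⟩
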